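/- Let $S^m$ be the unit sphere of $\mathbb{R}^{m+1}$. For $P,Q\in S^m$ put $|PQ|=\arccos(P\cdot Q)$, $S_P=\{Q\in S^m: P\cdot Q=0\}$ and $S_P^+=\{Q\in S^m: P\cdot Q\ge 0\}$. The spherical polar set of $W\subseteq S^m$ is $W^\circ=\bigcap_{P\in W}S_P^+$. A spherical convex body is a closed set $K\subseteq S^m$ with nonempty interior in $S^m$ such that $\{\lambda u:\lambda>0,\ u\in K\}$ is convex; its diameter is $\operatorname{diam}(K)=\max\{|PQ|:P,Q\in K\}$. The hemisphere $S_P^+$ supports $K$ if $K\subseteq S_P^+$ and $\partial K\cap S_P\neq\emptyset$, and then the width of $K$ with respect to $S_P^+$ is $$\operatorname{width}_{S_P^+}(K)=\min\{\pi-|PQ| : Q\in S^m,\ Q\ne\pm P,\ K\subseteq S_Q^+\}.$$ The width $\Delta(K)$ of $K$ is the minimum of $\operatorname{width}_{S_P^+}(K)$ over all supporting hemispheres $S_P^+$ of $K$, and $K$ is of constant width if all the numbers $\operatorname{width}_{S_P^+}(K)$ are equal (to $\Delta(K)$, then). Let $n\ge 0$ be an integer, let $\gamma:S^n\to(0,\infty)$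 be continuous, and let $\mathcal{W}_\gamma=\{x\in\mathbb{R}^{n+1}: x\cdot\theta\le\gamma(\theta)\text{ for all }\theta\in S^n\}$ be its Wulff shape. The spherical Wulff shape of $\mathcal{W}_\gamma$ is $$\widetilde W_\gamma=\Bigl\{P\in S^{n+1}: P_{n+2}>0,\ \Bigl(\tfrac{P_1}{P_{n+2}},\dots,\tfrac{P_{n+1}}{P_{n+2}}\Bigr)\in\mathcal{W}_\gamma\Bigr\}.$$ Corollary. If $\widetilde W_\gamma$ is of constant width, then $\widetilde W_\gamma$ and $\widetilde W_\gamma^\circ$ are spherical convex bodies, $\widetilde W_\gamma^\circ$ is also of constant width, and 1. $\Delta(\widetilde W_\gamma)+\operatorname{diam}(\widetilde W_\gamma^\circ)=\pi$, 2. $\Delta(\widetilde W_\gamma)+\Delta(\widetilde W_\gamma^\circ)=\pi$, 3. $\operatorname{diam}(\widetilde W_\gamma)+\Delta(\widetilde W_\gamma^\circ)=\pi$, 4. $\operatorname{diam}(\widetilde W_\gamma)+\operatorname{diam}(\widetilde W_\gamma^\circ)=\pi$. -/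

import Mathlib

noncomputable section

namespace SphericalWulff

/-- The unit sphere `S^m` of `ℝ^(m+1)`, with the topology induced by `ℝ^(m+1)`. -/
abbrev Sph (m : ℕ) : Type := Metric.sphere (0 : EuclideanSpace ℝ (Fin (m + 1))) 1

/-- The scalar product of two points of the sphere, regarded as vectors of `ℝ^(m+1)`. -/
def dot {m : ℕ} (P Q : Sph m) : ℝ :=
  inner ℝ (P : EuclideanSpace ℝ (Fin (m + 1))) (Q : EuclideanSpace ℝ (Fin (m + 1)))

/-- The spherical distance `|PQ| = arccos (P ⬝ Q)`. -/
def sdist {m : ℕ} (P Q : Sph m) : ℝ := Real.arccos (dot P Q)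

/-- The set `S_P` of points orthogonal to `P`, the bounding hypersphere of the hemisphere of `P`. -/
def hypersphere {m : ℕ} (P : Sph m) : Set (Sph m) := {Q | dot P Q = 0}

/-- The closed hemisphere `S_P^+` centered at `P`. -/
def hemisphere {m : ℕ} (P : Sph m) : Set (Sph m) := {Q | 0 ≤ dot P Q}

/-- The spherical polar set `W° = ⋂ P ∈ W, S_P^+`. -/
def polar {m : ℕ} (W : Set (Sph m)) : Set (Sph m) := ⋂ P ∈ W, hemisphere P

/-- `K` is spherically convex: `{c u : c > 0, u ∈ K}` is convex. -/
def IsSphericallyConvex {m : ℕ} (K : Set (Sph m)) : Prop :=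
  Convex ℝ {x : EuclideanSpace ℝ (Fin (m + 1)) |
    ∃ c : ℝ, 0 < c ∧ ∃ u ∈ K, x = c • (u : EuclideanSpace ℝ (Fin (m + 1)))}

/-- Spherical convex body: closed, spherically convex, with nonempty interior in the sphere. -/
structure IsSphericalConvexBody {m : ℕ} (K : Set (Sph m)) : Prop where
  isClosed : IsClosed K
  convex : IsSphericallyConvex K
  interior_nonempty : (interior K).Nonempty

/-- The diameter `max {|PQ| : P, Q ∈ K}`. The distances lie in `[0, π]`, and for a nonempty closed
`K` the supremum is attained. -/
def sdiam {m : ℕ} (K : Set (Sph m)) : ℝ := sSup {d : ℝ | ∃ P ∈ K, ∃ Q ∈ K, d = sdist P Q}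

/-- The hemisphere centered at `P` supports `K`: it contains `K`, and its bounding hypersphere meets
the boundary of `K`. -/
def IsSupporting {m : ℕ} (K : Set (Sph m)) (P : Sph m) : Prop :=
  K ⊆ hemisphere P ∧ ∃ X ∈ frontier K, X ∈ hypersphere P

/-- The hemispheres centered at `P` and `Q` are different and not opposite, so that they
intersect in a lune. -/
def IsLunePair {m : ℕ} (P Q : Sph m) : Prop := P ≠ Q ∧ P ≠ -Q

/-- The thickness `π - |PQ|` of the lune `S_P^+ ∩ S_Q^+`. -/
def luneThickness {m : ℕ} (P Q : Sph m) : ℝ := Real.pi - sdist P Q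

/-- The width of `K` with respect to its supporting hemisphere centered at `P`: the least thickness
of a lune `S_P^+ ∩ S_Q^+` with `K ⊆ S_Q^+`. -/
def widthAt {m : ℕ} (K : Set (Sph m)) (P : Sph m) : ℝ :=
  sInf {t : ℝ | ∃ Q : Sph m, IsLunePair P Q ∧ K ⊆ hemisphere Q ∧ t = luneThickness P Q}

/-- All widths of `K` with respect to supporting hemispheres are equal. -/
def HasConstantWidth {m : ℕ} (K : Set (Sph m)) : Prop :=
  ∀ P P' : Sph m, IsSupporting K P → IsSupporting K P' → widthAt K P = widthAt K P'

/-- The width (thickness) `Δ(K)`: the least width with respect to a supporting hemisphere. For a body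
of constant width it is the common value of all these widths. -/
def swidth {m : ℕ} (K : Set (Sph m)) : ℝ :=
  sInf {w : ℝ | ∃ P : Sph m, IsSupporting K P ∧ w = widthAt K P}

/-- The Wulff shape `{x ∈ ℝ^(n+1) : x ⬝ θ ≤ γ θ for all θ ∈ S^n}`. -/
def wulffShape {n : ℕ} (γ : Sph n → ℝ) : Set (EuclideanSpace ℝ (Fin (n + 1))) :=
  ⋂ θ : Sph n, {x | inner ℝ x (θ : EuclideanSpace ℝ (Fin (n + 1))) ≤ γ θ}

/-- The embedding `x ↦ (x, 1)` of `ℝ^(n+1)` into `ℝ^(n+2)`. -/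
def liftOne {n : ℕ} (x : EuclideanSpace ℝ (Fin (n + 1))) : EuclideanSpace ℝ (Fin (n + 2)) :=
  WithLp.toLp 2 (Fin.snoc (α := fun _ => ℝ) (fun i => x i) 1)

/-- The north pole `N = (0, …, 0, 1)` of `S^(n+1)`. -/
def northPole (n : ℕ) : Sph (n + 1) :=
  ⟨EuclideanSpace.single (Fin.last (n + 1)) 1, by simp⟩

/-- The open northern hemisphere of `S^(n+1)`. -/
def northOpen (n : ℕ) : Set (Sph (n + 1)) := hemisphere (northPole n) \ hypersphere (northPole n)

/-- The central projection relative to `N`: divide every coordinate by the last one. It is used only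
on the open northern hemisphere, where the last coordinate is positive. -/
def centralProj {n : ℕ} (P : Sph (n + 1)) : EuclideanSpace ℝ (Fin (n + 2)) :=
  WithLp.toLp 2 (fun i => P.1 i / P.1 (Fin.last (n + 1)))

/-- The spherical Wulff shape: the points of the open northern hemisphere whose central projection
lies in the copy of the Wulff shape at height one. -/
def sphericalWulffShape {n : ℕ} (γ : Sph n → ℝ) : Set (Sph (n + 1)) :=
  {P | P ∈ northOpen n ∧ centralProj P ∈ liftOne '' wulffShape γ}

end SphericalWulff

end

/-! Let `K` be the spherical Wulff shape and `L` its polar. Hemispheres containing `K` are those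
centered in `L`, and the supporting ones are centered at points of `L` orthogonal to some point of
`K`. Minimizing `π - |PQ|` over `Q ∈ L` is maximizing `|PQ|`, so constant width of `K` means that
all boundary points of `L` have the same farthest distance `D = arccos c` in `L`
(`IsDualPair.exists_isConstDiam`).

The core is `IsConstDiam.dual`: then `K` has constant diameter `π - D`. The main tool is first
variation (`exists_normal`): at a farthest point the tangential part of the direction is an outer
normal, hence gives a point of the polar body. The upper bound on the diameter of `K` (`neg_le_dot`)
splits by the sign of `c`; for `c > 0` it uses that `L` is the intersection of the balls of radius
`D` around its points (`mem_of_le_dot`). Width and diameter of both bodies are then explicit in `c`,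
and `arccos (-c) = π - arccos c` gives all four identities. -/

namespace SphericalWulff

/-! ### Scalar products on the sphere -/

section Basic

variable {m : ℕ}

lemma dot_comm (P Q : Sph m) : dot P Q = dot Q P := real_inner_comm _ _

lemma norm_coe (P : Sph m) : ‖(P : EuclideanSpace ℝ (Fin (m + 1)))‖ = 1 := by
  simp

@[simp] lemma dot_self (P : Sph m) : dot P P = 1 := by
  simp [dot, norm_coe P]

lemma dot_le_one (P Q : Sph m) : dot P Q ≤ 1 := by
  simpa [norm_coe, dot] using real_inner_le_norm (P : EuclideanSpace ℝ (Fin (m + 1))) Q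

lemma neg_one_le_dot (P Q : Sph m) : -1 ≤ dot P Q := by
  simpa [norm_coe, dot] using
    (abs_le.1 (abs_real_inner_le_norm (P : EuclideanSpace ℝ (Fin (m + 1))) Q)).1

lemma eq_of_dot_eq_one {P Q : Sph m} (h : dot P Q = 1) : P = Q :=
  Subtype.ext ((inner_eq_one_iff_of_norm_eq_one (𝕜 := ℝ) (norm_coe P) (norm_coe Q)).1 h)

@[simp] lemma neg_dot (P Q : Sph m) : dot (-P) Q = -dot P Q := by
  simp [dot]

@[simp] lemma dot_neg (P Q : Sph m) : dot P (-Q) = -dot P Q := by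
  simp [dot]

lemma eq_neg_of_dot_eq_neg_one {P Q : Sph m} (h : dot P Q = -1) : P = -Q :=
  eq_of_dot_eq_one (by simp [h])

lemma continuous_dot : Continuous fun p : Sph m × Sph m => dot p.1 p.2 := by
  unfold dot; fun_prop

lemma continuous_dot_left (P : Sph m) : Continuous (dot P) :=
  continuous_dot.comp (by fun_prop : Continuous fun Q => (P, Q))

/-- Every nonzero vector is a positive multiple of a point of the sphere. -/
lemma exists_normalize {v : EuclideanSpace ℝ (Fin (m + 1))} (hv : v ≠ 0) :
    ∃ Z : Sph m, v = ‖v‖ • (Z : EuclideanSpace ℝ (Fin (m + 1))) := by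
  have h : ‖v‖ ≠ 0 := norm_ne_zero_iff.2 hv
  refine ⟨⟨‖v‖⁻¹ • v, ?_⟩, ?_⟩
  · simp [norm_smul, h]
  · simp [smul_smul, h]

/-- Bessel's inequality for two orthogonal points. -/
lemma sq_dot_add_sq_dot_le_one {X P : Sph m} (h : dot X P = 0) (x : Sph m) :
    dot x X ^ 2 + dot x P ^ 2 ≤ 1 := by
  have h1 := @real_inner_self_nonneg _ _ _ ((x : EuclideanSpace ℝ (Fin (m + 1)))
    - dot x X • (X : EuclideanSpace ℝ (Fin (m + 1))) - dot x P • (P : EuclideanSpace ℝ (Fin (m + 1))))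
  have hx := dot_self x
  have hX := dot_self X
  have hP := dot_self P
  have h' := dot_comm X P
  have e1 := dot_comm x X
  have e2 := dot_comm x P
  simp only [inner_sub_left, inner_sub_right, inner_smul_left, inner_smul_right, conj_trivial] at h1
  simp only [← dot.eq_1] at h1
  rw [← h', ← e1, ← e2, h, hx, hX, hP] at h1
  linarith

end Basic

/-! ### Polar pairs, normals and extremal distances -/

/-- `K` and `L` are polar to each other, and each contains a point that is interior in the sense
that it has positive scalar product with all points of the other one. -/
structure IsDualPair {m : ℕ} (K L : Set (Sph m)) : Prop where
  mem_left : ∀ X, X ∈ K ↔ ∀ P ∈ L, 0 ≤ dot X P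
  mem_right : ∀ P, P ∈ L ↔ ∀ X ∈ K, 0 ≤ dot P X
  exists_left : ∃ o ∈ K, ∀ P ∈ L, 0 < dot o P
  exists_right : ∃ o ∈ L, ∀ X ∈ K, 0 < dot o X

namespace IsDualPair

variable {m : ℕ} {K L : Set (Sph m)}

lemma symm (h : IsDualPair K L) : IsDualPair L K :=
  ⟨h.mem_right, h.mem_left, h.exists_right, h.exists_left⟩

lemma dot_nonneg (h : IsDualPair K L) {X P : Sph m} (hX : X ∈ K) (hP : P ∈ L) : 0 ≤ dot X P :=
  (h.mem_left X).1 hX P hP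

lemma isClosed_left (h : IsDualPair K L) : IsClosed K := by
  have : K = ⋂ P ∈ L, {X | 0 ≤ dot P X} := by
    ext X
    simp [h.mem_left X, dot_comm X]
  rw [this]
  exact isClosed_biInter fun P _ => isClosed_le continuous_const (continuous_dot_left P)

lemma isCompact_left (h : IsDualPair K L) : IsCompact K := h.isClosed_left.isCompact

lemma neg_one_lt_dot (h : IsDualPair K L) {X Y : Sph m} (hX : X ∈ K) (hY : Y ∈ K) :
    -1 < dot X Y := by
  refine lt_of_le_of_ne (neg_one_le_dot X Y) fun he => ?_
  obtain ⟨o, -, ho⟩ := h.exists_right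
  have h1 := ho X hX
  rw [eq_neg_of_dot_eq_neg_one he.symm, dot_neg] at h1
  linarith [ho Y hY]

/-- The point of `K` in the direction of a vector with nonnegative scalar products with `L`. -/
lemma exists_mem_left (h : IsDualPair K L) {v : EuclideanSpace ℝ (Fin (m + 1))} (hv : v ≠ 0)
    (hL : ∀ P ∈ L, 0 ≤ inner ℝ v (P : EuclideanSpace ℝ (Fin (m + 1)))) :
    ∃ Z ∈ K, v = ‖v‖ • (Z : EuclideanSpace ℝ (Fin (m + 1))) := by
  obtain ⟨Z, hZ⟩ := exists_normalize hv
  refine ⟨Z, (h.mem_left Z).2 fun P hP => ?_, hZ⟩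
  have h1 := hL P hP
  rw [hZ, inner_smul_left] at h1
  exact nonneg_of_mul_nonneg_right h1 (norm_pos_iff.2 hv)

/-- If `y ↦ R ⬝ y` is minimal on `L` at `P`, then the part of `R` orthogonal to `P` points
to `K`. -/
lemma exists_normal (h : IsDualPair K L) {R P : Sph m} {c : ℝ} (hc : c ^ 2 < 1) (hP : P ∈ L)
    (hRP : dot R P = c) (hmin : ∀ y ∈ L, c ≤ dot R y) :
    ∃ Z ∈ K, ∀ x, dot R x = c * dot P x + √(1 - c ^ 2) * dot Z x := by
  set V : EuclideanSpace ℝ (Fin (m + 1)) := (R : EuclideanSpace ℝ (Fin (m + 1))) - c • P.1 with hV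
  have hin : ∀ x : Sph m, inner ℝ V (x : EuclideanSpace ℝ (Fin (m + 1)))
      = dot R x - c * dot P x := fun x => by
    simp [hV, inner_sub_left, inner_smul_left, dot]
  have hVV : ‖V‖ ^ 2 = 1 - c ^ 2 := by
    rw [← real_inner_self_eq_norm_sq]
    nth_rw 2 [hV]
    rw [inner_sub_right, inner_smul_right, hin, hin, dot_self, hRP, dot_self, dot_comm P R, hRP]
    ring
  have hn : ‖V‖ = √(1 - c ^ 2) := by rw [← hVV, Real.sqrt_sq (norm_nonneg _)]
  have hV0 : V ≠ 0 := by
    rw [← norm_pos_iff, hn]; exact Real.sqrt_pos.2 (by linarith)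
  obtain ⟨Z, hZK, hZ⟩ := h.exists_mem_left hV0 fun y hy => by
    rw [hin]
    -- First variation: `P + t y` stays in the cone over `L`; comparing there gives the inequality
    -- up to an error `t`.
    refine le_of_forall_pos_le_add fun t ht => ?_
    set W : EuclideanSpace ℝ (Fin (m + 1)) := P.1 + t • y.1 with hW
    have hWin : ∀ x : Sph m, inner ℝ W (x : EuclideanSpace ℝ (Fin (m + 1)))
      = dot P x + t * dot y x := fun x => by
      simp [hW, inner_add_left, inner_smul_left, dot]
    have hW0 : W ≠ 0 := by
      rintro h0
      obtain ⟨o, -, ho⟩ := h.exists_left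
      have h1 := hWin o
      rw [h0, inner_zero_left, dot_comm P, dot_comm y] at h1
      have := ho P hP
      have := mul_pos ht (ho y hy)
      linarith
    obtain ⟨Y, hYL, hY⟩ := h.symm.exists_mem_left hW0 fun X hX => by
      rw [hWin, dot_comm P, dot_comm y]
      have := h.dot_nonneg hX hP
      have := mul_nonneg ht.le (h.dot_nonneg hX hy)
      linarith
    have hRW := hWin R
    rw [hY, inner_smul_left, conj_trivial, ← dot.eq_1, dot_comm P R, hRP, dot_comm Y R,
      dot_comm y R] at hRW
    have h2 := mul_le_mul_of_nonneg_left (hmin Y hYL) (norm_nonneg W)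
    have hPW := hWin P
    rw [dot_self, dot_comm y P] at hPW
    have h3 : 1 + t * dot P y ≤ ‖W‖ := by
      rw [← hPW]
      simpa [norm_coe] using real_inner_le_norm W P.1
    have h4 : ‖W‖ ^ 2 = 1 + 2 * (t * dot P y) + t ^ 2 := by
      rw [← real_inner_self_eq_norm_sq]
      nth_rw 2 [hW]
      rw [inner_add_right, inner_smul_right, hWin, hWin, dot_self, dot_self, dot_comm y P]
      ring
    have h5 : ‖W‖ ≤ 1 + t * dot P y + t ^ 2 / 2 := by
      nlinarith [sq_nonneg (‖W‖ - 1)]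
    have hc1 : -1 ≤ c := by nlinarith
    have h6 : c * (1 + t * dot P y) - t ^ 2 ≤ c * ‖W‖ := by
      -- The sign of `c` decides whether the lower bound `h3` or the upper bound `h5` on `‖W‖` is
      -- used.
      rcases le_total 0 c with h0 | h0
      · nlinarith
      · nlinarith
    have h7 : 0 ≤ t * (dot R y - c * dot P y + t) := by nlinarith
    exact nonneg_of_mul_nonneg_right h7 ht
  refine ⟨Z, hZK, fun x => ?_⟩
  have := hin x
  rw [hZ, inner_smul_left, conj_trivial, hn, ← dot.eq_1] at this
  linarith

/-- Every point of `K` has a farthest point in `K`. -/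
lemma exists_min (h : IsDualPair K L) (X : Sph m) : ∃ Y ∈ K, ∀ y ∈ K, dot X Y ≤ dot X y := by
  obtain ⟨o, ho, -⟩ := h.exists_left
  exact h.isCompact_left.exists_isMinOn ⟨o, ho⟩ (continuous_dot_left X).continuousOn

/-- The diameter of `K` is attained. -/
lemma exists_min_pair (h : IsDualPair K L) :
    ∃ X ∈ K, ∃ Y ∈ K, ∀ x ∈ K, ∀ y ∈ K, dot X Y ≤ dot x y := by
  obtain ⟨o, ho, -⟩ := h.exists_left
  obtain ⟨⟨X, Y⟩, ⟨hX, hY⟩, hmin⟩ := (h.isCompact_left.prod h.isCompact_left).exists_isMinOn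
    ⟨(o, o), ho, ho⟩ continuous_dot.continuousOn
  exact ⟨X, hX, Y, hY, fun x hx y hy => hmin (Set.mk_mem_prod hx hy)⟩

end IsDualPair

lemma exists_dot_eq_zero {m : ℕ} (hm : 0 < m) (P : Sph m) : ∃ X : Sph m, dot P X = 0 := by
  obtain ⟨k, rfl⟩ : ∃ k, m = k + 1 := ⟨m - 1, by omega⟩
  have : Fact (Module.finrank ℝ (EuclideanSpace ℝ (Fin (k + 1 + 1))) = (k + 1) + 1) := ⟨by simp⟩
  have hP : (P : EuclideanSpace ℝ (Fin (k + 1 + 1))) ≠ 0 := by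
    rw [← norm_pos_iff, norm_coe]; exact one_pos
  have hfin := Submodule.finrank_orthogonal_span_singleton (𝕜 := ℝ) (n := k + 1) hP
  have hnt : Nontrivial (Submodule.span ℝ {(P : EuclideanSpace ℝ (Fin (k + 1 + 1)))})ᗮ :=
    Module.nontrivial_of_finrank_pos (R := ℝ) (by omega)
  obtain ⟨v, hv⟩ := exists_ne (0 : (Submodule.span ℝ {P.1})ᗮ)
  have hv0 : (v : EuclideanSpace ℝ (Fin (k + 1 + 1))) ≠ 0 := by simpa using hv
  obtain ⟨X, hX⟩ := exists_normalize hv0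
  have h1 := Submodule.mem_orthogonal_singleton_iff_inner_right.1 v.2
  rw [hX, inner_smul_right, ← dot.eq_1] at h1
  exact ⟨X, (mul_eq_zero.1 h1).resolve_left (norm_ne_zero_iff.2 hv0)⟩

/-! ### Constant diameter and its duality -/

/-- `L` has constant diameter `arccos c`: no distance in `L` is larger, and every boundary point of
`L` (a point orthogonal to some point of the dual body `K`) has a point of `L` at this distance. -/
structure IsConstDiam {m : ℕ} (K L : Set (Sph m)) (c : ℝ) : Prop where
  le_dot : ∀ P ∈ L, ∀ Q ∈ L, c ≤ dot P Q
  exists_dot_eq : ∀ P ∈ L, (∃ X ∈ K, dot X P = 0) → ∃ Q ∈ L, dot P Q = c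

lemma sqrt_one_sub_sq_pos {c : ℝ} (h1 : -1 < c) (h2 : c < 1) : 0 < √(1 - c ^ 2) :=
  Real.sqrt_pos.2 (by nlinarith)

lemma sq_sqrt_one_sub_sq {c : ℝ} (h1 : -1 < c) (h2 : c < 1) : √(1 - c ^ 2) ^ 2 = 1 - c ^ 2 :=
  Real.sq_sqrt (by nlinarith)

namespace IsDualPair

variable {m : ℕ} {K L : Set (Sph m)} {c : ℝ}

/-- A boundary point is not the only point of the body. -/
lemma exists_dot_lt_one_of_boundary (h : IsDualPair K L) {P : Sph m}
    (hb : ∃ X ∈ K, dot X P = 0) : ∃ o ∈ L, dot P o < 1 := by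
  obtain ⟨o, ho, ho'⟩ := h.exists_right
  refine ⟨o, ho, lt_of_le_of_ne (dot_le_one _ _) fun he => ?_⟩
  obtain ⟨X, hX, hXP⟩ := hb
  have := ho' X hX
  rw [← eq_of_dot_eq_one he, dot_comm, hXP] at this
  exact lt_irrefl _ this

/-- If `L` were the single point `o`, any point orthogonal to `o` would lie in `K`, yet `o` can be
chosen with positive products on `K`. Such an orthogonal point needs `0 < m`. -/
lemma exists_dot_lt_one (h : IsDualPair K L) (hm : 0 < m) : ∃ P ∈ L, ∃ Q ∈ L, dot P Q < 1 := by
  obtain ⟨o, ho, ho'⟩ := h.exists_right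
  by_contra! hcon
  have heq : ∀ x ∈ L, x = o := fun x hx =>
    eq_of_dot_eq_one (le_antisymm (dot_le_one _ _) (hcon x hx o ho))
  obtain ⟨X, hX⟩ := exists_dot_eq_zero hm o
  have hXK : X ∈ K := (h.mem_left X).2 fun P hP => by
    rw [heq P hP, dot_comm, hX]
  exact (ho' X hXK).ne' hX

/-- The diameter of `K` is attained at a pair of points `X`, `Y` for which the lune with these
centers contains `L`, the centers `P`, `Q` of its edges belonging to `L`. -/
lemma exists_lune (h : IsDualPair K L) (hm : 0 < m) :
    ∃ X ∈ K, ∃ Y ∈ K, ∃ P ∈ L, ∃ Q ∈ L, (∀ x ∈ K, ∀ y ∈ K, dot X Y ≤ dot x y) ∧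
      -1 < dot X Y ∧ dot X Y < 1 ∧
      (∀ x, dot Y x = dot X Y * dot X x + √(1 - dot X Y ^ 2) * dot P x) ∧
      (∀ x, dot X x = dot X Y * dot Y x + √(1 - dot X Y ^ 2) * dot Q x) := by
  obtain ⟨X, hX, Y, hY, hmin⟩ := h.exists_min_pair
  obtain ⟨A, hA, B, hB, hAB⟩ := h.symm.exists_dot_lt_one hm
  have h1 : dot X Y < 1 := (hmin A hA B hB).trans_lt hAB
  have h2 := h.neg_one_lt_dot hX hY
  have h3 : dot X Y ^ 2 < 1 := by nlinarith
  obtain ⟨P, hP, hP'⟩ := h.symm.exists_normal h3 hX (dot_comm Y X) fun y hy => hmin Y hY y hy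
  obtain ⟨Q, hQ, hQ'⟩ := h.symm.exists_normal h3 hY rfl fun y hy => hmin X hX y hy
  exact ⟨X, hX, Y, hY, P, hP, Q, hQ, hmin, h2, h1, hP', hQ'⟩

/-- Diametral points lie on the boundary: the edge center `P` of the lune is orthogonal to `X`. This
supplies supporting hemispheres. -/
lemma exists_boundary_min_pair (h : IsDualPair K L) (hm : 0 < m) :
    ∃ X ∈ K, ∃ Y ∈ K, (∃ P ∈ L, dot P X = 0) ∧ ∀ x ∈ K, ∀ y ∈ K, dot X Y ≤ dot x y := by
  obtain ⟨X, hX, Y, hY, P, hP, Q, hQ, hmin, h2, h1, hP', hQ'⟩ := h.exists_lune hm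
  refine ⟨X, hX, Y, hY, ⟨P, hP, ?_⟩, hmin⟩
  have := hP' X
  rw [dot_self, dot_comm Y X] at this
  have hs := sqrt_one_sub_sq_pos h2 h1
  refine (mul_eq_zero.1 (?_ : √(1 - dot X Y ^ 2) * dot P X = 0)).resolve_left hs.ne'
  linarith

end IsDualPair

namespace IsConstDiam

variable {m : ℕ} {K L : Set (Sph m)} {c : ℝ}

lemma lt_one (hc : IsConstDiam K L c) (h : IsDualPair K L) (hm : 0 < m) : c < 1 := by
  obtain ⟨P, hP, Q, hQ, hlt⟩ := h.exists_dot_lt_one hm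
  exact (hc.le_dot P hP Q hQ).trans_lt hlt

lemma neg_one_lt (hc : IsConstDiam K L c) (h : IsDualPair K L) (hm : 0 < m) : -1 < c := by
  obtain ⟨P, hP, Q, hQ, hb, hmin⟩ := h.symm.exists_boundary_min_pair hm
  obtain ⟨R, hR, hPR⟩ := hc.exists_dot_eq P hP hb
  exact hPR ▸ h.symm.neg_one_lt_dot hP hR

/-- The lune with center `P` and its partner `R`, and the centers `Z`, `X'` of its edges. -/
lemma exists_partner (hc : IsConstDiam K L c) (h : IsDualPair K L) (hm : 0 < m) {P : Sph m}
    (hP : P ∈ L) (hb : ∃ X ∈ K, dot X P = 0) :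
    ∃ R ∈ L, dot P R = c ∧
      (∃ Z ∈ K, ∀ x, dot R x = c * dot P x + √(1 - c ^ 2) * dot Z x) ∧
      ∃ X' ∈ K, ∀ x, dot P x = c * dot R x + √(1 - c ^ 2) * dot X' x := by
  obtain ⟨R, hR, hPR⟩ := hc.exists_dot_eq P hP hb
  have h1 := hc.lt_one h hm
  have h2 := hc.neg_one_lt h hm
  have h3 : c ^ 2 < 1 := by nlinarith
  exact ⟨R, hR, hPR,
    h.exists_normal h3 hP (by rw [dot_comm, hPR]) fun y hy => hc.le_dot R hR y hy,
    h.exists_normal h3 hR hPR fun y hy => hc.le_dot P hP y hy⟩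

/-- A body of constant diameter at most `π / 2` is the intersection of the balls of this radius
around its points. -/
lemma mem_of_le_dot (hc : IsConstDiam K L c) (h : IsDualPair K L) (hm : 0 < m) (hc0 : 0 ≤ c)
    {y : Sph m} (hy : ∀ x ∈ L, c ≤ dot y x) : y ∈ L := by
  by_contra hyL
  obtain ⟨X₁, hX₁, hyX₁⟩ : ∃ X ∈ K, dot y X < 0 := by
    by_contra! hcon
    exact hyL ((h.mem_right y).2 hcon)
  obtain ⟨o, ho, ho'⟩ := h.exists_right
  have hcont : ContinuousOn (fun X => dot y X / dot o X) K :=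
    (continuous_dot_left y).continuousOn.div (continuous_dot_left o).continuousOn
      fun X hX => (ho' X hX).ne'
  obtain ⟨X₀, hX₀, hmin⟩ := h.isCompact_left.exists_isMinOn ⟨X₁, hX₁⟩ hcont
  -- The least `t` for which `y + t o` lies in the cone over `L`; there it is orthogonal to `X₀`,
  -- hence a boundary direction.
  obtain ⟨t, ht⟩ : ∃ t, t = -(dot y X₀ / dot o X₀) := ⟨_, rfl⟩
  have ht0 : 0 < t := by
    have h1 : dot y X₀ / dot o X₀ ≤ dot y X₁ / dot o X₁ := hmin hX₁
    have h2 := div_neg_of_neg_of_pos hyX₁ (ho' X₁ hX₁)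
    linarith
  have hX₀' : dot y X₀ + t * dot o X₀ = 0 := by
    have := (ho' X₀ hX₀).ne'
    rw [ht]; field_simp; ring
  set W : EuclideanSpace ℝ (Fin (m + 1)) := y.1 + t • o.1 with hW
  have hWin : ∀ x : Sph m, inner ℝ W (x : EuclideanSpace ℝ (Fin (m + 1)))
    = dot y x + t * dot o x := fun x => by
    simp [hW, inner_add_left, inner_smul_left, dot]
  have hW0 : W ≠ 0 := by
    intro h0
    have h1 := hWin o
    rw [h0, inner_zero_left, dot_self] at h1
    linarith [hy o ho]
  obtain ⟨p, hp, hWp⟩ := h.symm.exists_mem_left hW0 fun X hX => by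
    rw [hWin]
    have h1 : dot y X₀ / dot o X₀ ≤ dot y X / dot o X := hmin hX
    rw [le_div_iff₀ (ho' X hX)] at h1
    rw [ht]; linarith
  have hpos := norm_pos_iff.2 hW0
  have hpin : ∀ x, dot y x + t * dot o x = ‖W‖ * dot p x := fun x => by
    rw [← hWin x]
    nth_rw 1 [hWp]
    rw [inner_smul_left, conj_trivial, dot]
  have hb : ∃ X ∈ K, dot X p = 0 := ⟨X₀, hX₀, by
    rw [dot_comm]
    have h1 := hpin X₀
    rw [hX₀'] at h1
    exact (mul_eq_zero.1 h1.symm).resolve_left hpos.ne'⟩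
  obtain ⟨r, hr, hpr⟩ := hc.exists_dot_eq p hp hb
  -- An interior point is never at the full distance: otherwise the normal `Z ∈ K` at `o` would be
  -- orthogonal to `o`.
  have hor : c < dot o r := by
    refine lt_of_le_of_ne (hc.le_dot o ho r hr) fun he => ?_
    have h1 := hc.lt_one h hm
    have h2 := hc.neg_one_lt h hm
    obtain ⟨Z, hZ, hZ'⟩ := h.exists_normal (by nlinarith) ho (by rw [dot_comm, he])
      fun y hy => hc.le_dot r hr y hy
    have h3 := hZ' o
    rw [dot_self, dot_comm r o, ← he, dot_comm Z o] at h3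
    have := mul_pos (sqrt_one_sub_sq_pos h2 h1) (ho' Z hZ)
    linarith
  have hn : ‖W‖ ≤ 1 + t := by
    refine (norm_add_le _ _).trans ?_
    rw [norm_smul, norm_coe, norm_coe, Real.norm_of_nonneg ht0.le, mul_one]
  have h1 := hpin r
  rw [hpr] at h1
  -- Here `c ≥ 0` matters: `c ‖W‖ ≤ c (1 + t)`, while pairing `W` with `r` gives strictly more than
  -- `c (1 + t)`.
  have h2 := mul_le_mul_of_nonneg_right hn hc0
  have h3 := mul_lt_mul_of_pos_left hor ht0
  linarith [hy r hr]

/-- A point outside the ball-convex body `L` near its boundary point `Q`. -/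
lemma false_of_spindle (hc : IsConstDiam K L c) (h : IsDualPair K L) (hm : 0 < m) (hc0 : 0 < c)
    {Q R Y : Sph m} (hQ : Q ∈ L) (hR : R ∈ L) (hY : Y ∈ K) (hYQ : dot Y Q = 0)
    (hlt : √(1 - c ^ 2) * dot Y R < c * (1 - dot Q R)) : False := by
  have h1 := hc.lt_one h hm
  have h2 := hc.neg_one_lt h hm
  set s := √(1 - c ^ 2) with hs
  have hs0 : 0 < s := sqrt_one_sub_sq_pos h2 h1
  have hs2 : s ^ 2 = 1 - c ^ 2 := sq_sqrt_one_sub_sq h2 h1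
  have hlt' : dot Y R < c * (1 - dot Q R) / s := by
    rw [lt_div_iff₀ hs0]; linarith
  -- `κ > Y ⬝ R` makes the direction `v` below leave the hemisphere of `Y`; the upper bound on `κ`
  -- keeps the path within distance `D` of all of `L`.
  obtain ⟨κ, hκ1, hκ2⟩ := exists_between hlt'
  rw [lt_div_iff₀ hs0] at hκ2
  have hYR := h.dot_nonneg hY hR
  have hκ0 : 0 < κ := hYR.trans_lt hκ1
  obtain ⟨q, hq⟩ : ∃ q, q = dot Q R := ⟨_, rfl⟩
  rw [← hq] at hκ2
  have hq1 : q ≤ 1 := hq ▸ dot_le_one _ _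
  set v : EuclideanSpace ℝ (Fin (m + 1)) := R.1 - q • Q.1 - κ • Y.1 with hv
  have hvin : ∀ x : Sph m, inner ℝ v (x : EuclideanSpace ℝ (Fin (m + 1)))
      = dot R x - q * dot Q x - κ * dot Y x := fun x => by
    simp [hv, inner_sub_left, inner_smul_left, dot]
  have hvQ : inner ℝ v (Q : EuclideanSpace ℝ (Fin (m + 1))) = 0 := by
    rw [hvin, dot_self, hYQ, dot_comm R Q, hq]; ring
  have hμ : 0 < c * (1 - q) - κ * s := by linarith
  -- `ε` is small enough for the first-order gain `c (1 - q) - κ s` to absorb the second-order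
  -- growth of `‖W‖`; `ε ≤ 1` gives `ε q ≤ 1`, used in `e2`.
  obtain ⟨ε, hε, hε1, hε2⟩ : ∃ ε : ℝ, 0 < ε ∧ ε ≤ 1 ∧ ε * (c * ‖v‖ ^ 2) ≤ c * (1 - q) - κ * s := by
    have hB : 0 ≤ c * ‖v‖ ^ 2 := by positivity
    refine ⟨min 1 ((c * (1 - q) - κ * s) / (c * ‖v‖ ^ 2 + 1)),
      lt_min one_pos (by positivity), min_le_left _ _, ?_⟩
    refine (mul_le_mul_of_nonneg_right (min_le_right _ _) hB).trans ?_
    rw [div_mul_eq_mul_div, div_le_iff₀ (by positivity)]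
    nlinarith
  set W : EuclideanSpace ℝ (Fin (m + 1)) := Q.1 + ε • v with hW
  have hWin : ∀ x : Sph m, inner ℝ W (x : EuclideanSpace ℝ (Fin (m + 1)))
      = dot Q x + ε * (dot R x - q * dot Q x - κ * dot Y x) := fun x => by
    rw [hW, inner_add_left, inner_smul_left, hvin]; simp [dot]
  have hWn : ‖W‖ ^ 2 = 1 + ε ^ 2 * ‖v‖ ^ 2 := by
    rw [hW, norm_add_sq_real, inner_smul_right, real_inner_comm, hvQ, norm_coe, norm_smul,
      Real.norm_of_nonneg hε.le]
    ring
  have hWn0 : 0 < ‖W‖ := by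
    have : 0 < ‖W‖ ^ 2 := by rw [hWn]; positivity
    exact lt_of_le_of_ne (norm_nonneg _) fun h0 => by rw [← h0] at this; norm_num at this
  have hWle : ‖W‖ ≤ 1 + ε ^ 2 * ‖v‖ ^ 2 := by
    have : 0 ≤ ε ^ 2 * ‖v‖ ^ 2 := by positivity
    nlinarith
  obtain ⟨y, hWy⟩ := exists_normalize (norm_pos_iff.1 hWn0)
  have hyin : ∀ x, ‖W‖ * dot y x = dot Q x + ε * (dot R x - q * dot Q x - κ * dot Y x) :=
    fun x => by
      rw [← hWin x]
      nth_rw 2 [hWy]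
      rw [inner_smul_left, conj_trivial, dot]
  have hyL : y ∈ L := hc.mem_of_le_dot h hm hc0.le fun x hx => by
    refine le_of_mul_le_mul_left ?_ hWn0
    rw [hyin]
    have hQx := hc.le_dot Q hQ x hx
    have hRx := hc.le_dot R hR x hx
    -- Bessel with `Y ⊥ Q` and `Q ⬝ x ≥ c > 0`.
    have hYx : dot Y x ≤ s := by
      have := sq_dot_add_sq_dot_le_one hYQ x
      rw [dot_comm x Y, dot_comm x Q] at this
      nlinarith
    have e1 : κ * dot Y x ≤ κ * s := mul_le_mul_of_nonneg_left hYx hκ0.le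
    have e2 : 0 ≤ (1 - ε * q) * (dot Q x - c) := by
      refine mul_nonneg ?_ (by linarith)
      nlinarith
    have e3 := mul_le_mul_of_nonneg_right hWle hc0.le
    have e4 := mul_le_mul_of_nonneg_left hε2 hε.le
    have e5 := mul_le_mul_of_nonneg_left e1 hε.le
    have e6 := mul_le_mul_of_nonneg_left hRx hε.le
    linarith
  have hYy := h.dot_nonneg hY hyL
  have h3 := hyin Y
  rw [dot_self, dot_comm Q Y, hYQ, dot_comm R Y, dot_comm y Y] at h3
  have h4 := mul_nonneg hWn0.le hYy
  have h5 : 0 < ε * (κ - dot Y R) := mul_pos hε (by linarith)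
  linarith

/-- The polar of a body of constant diameter `D` has diameter at most `π - D`. -/
lemma neg_le_dot (hc : IsConstDiam K L c) (h : IsDualPair K L) (hm : 0 < m) :
    ∀ X ∈ K, ∀ Y ∈ K, -c ≤ dot X Y := by
  obtain ⟨X, hX, Y, hY, P, hP, Q, hQ, hmin, hd2, hd1, hPin, hQin⟩ := h.exists_lune hm
  suffices hd : -c ≤ dot X Y from fun x hx y hy => hd.trans (hmin x hx y hy)
  by_contra! hlt
  obtain ⟨d, hd⟩ : ∃ d, d = dot X Y := ⟨_, rfl⟩
  rw [← hd] at hmin hd2 hd1 hPin hQin hlt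
  have hc1 := hc.lt_one h hm
  have hc2 := hc.neg_one_lt h hm
  have hs0 := sqrt_one_sub_sq_pos hc2 hc1
  have hs2 := sq_sqrt_one_sub_sq hc2 hc1
  have he0 := sqrt_one_sub_sq_pos hd2 hd1
  have he2 := sq_sqrt_one_sub_sq hd2 hd1
  set e := √(1 - d ^ 2)
  have hXP : dot X P = 0 := by
    have h1 := hPin X
    rw [dot_self, dot_comm Y X, ← hd] at h1
    rw [dot_comm]
    exact (mul_eq_zero.1 (by linarith : e * dot P X = 0)).resolve_left he0.ne'
  have hYQ : dot Y Q = 0 := by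
    have h1 := hQin Y
    rw [dot_self, ← hd] at h1
    rw [dot_comm]
    exact (mul_eq_zero.1 (by linarith : e * dot Q Y = 0)).resolve_left he0.ne'
  obtain ⟨R, hR, hPR, ⟨Z, hZ, hZin⟩, -⟩ := hc.exists_partner h hm hP ⟨X, hX, hXP⟩
  have hYR := hPin R
  rw [hPR] at hYR
  have hXR := hQin R
  have hYR0 := h.dot_nonneg hY hR
  have hXR0 := h.dot_nonneg hX hR
  -- For `c < 0`, `d < -c` and `X ⬝ R ≤ √(1 - c²)` force `Y ⬝ R < 0`. For `c = 0`, ball-convexity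
  -- gives `K ⊆ L`, so `d ≥ 0`. For `c > 0`, `L` would fail to be ball-convex near `Q`.
  rcases lt_trichotomy c 0 with hneg | hzero | hpos
  · have h1 := hZin X
    rw [dot_comm P X, hXP, dot_comm R X] at h1
    have h2 : dot Z X ≤ 1 := dot_le_one _ _
    have h3 : dot X R ≤ √(1 - c ^ 2) := by nlinarith
    rcases le_total d 0 with hd0 | hd0
    · nlinarith [mul_pos he0 (neg_pos.2 hneg)]
    · have h4 : (d * √(1 - c ^ 2)) < e * (-c) := by
        refine lt_of_pow_lt_pow_left₀ 2 (by nlinarith) ?_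
        rw [mul_pow, mul_pow, hs2, he2]
        nlinarith
      nlinarith
  · subst hzero
    have hsub : ∀ y ∈ K, y ∈ L := fun y hy =>
      hc.mem_of_le_dot h hm le_rfl fun x hx => h.dot_nonneg hy hx
    have := hc.le_dot X (hsub X hX) Y (hsub Y hY)
    rw [← hd] at this
    linarith
  · refine hc.false_of_spindle h hm hpos hQ hR hY hYQ ?_
    set s := √(1 - c ^ 2)
    have hq : dot Q R = e * dot X R - d * c := by
      have h1 : e * dot Q R = e * (e * dot X R - d * c) := by
        rw [hYR] at hXR
        linear_combination (-1) * hXR - dot X R * he2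
      exact mul_left_cancel₀ he0.ne' h1
    rw [hq, hYR]
    -- For the unit vectors `(s, c)` and `(e, -d)`, this is strict Cauchy–Schwarz; they differ since
    -- `-d > c`.
    have h1 : s * e - d * c < 1 := by
      nlinarith [sq_nonneg (s - e), mul_pos (show 0 < -c - d by linarith) (show 0 < -c - d by linarith)]
    have h2 : c * e < s * (-d) := by
      refine lt_of_pow_lt_pow_left₀ 2 (by nlinarith) ?_
      rw [mul_pow, mul_pow, hs2, he2]
      nlinarith
    have h3 : 0 ≤ dot X R * (s * (-d) - c * e) := mul_nonneg hXR0 (by linarith)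
    have h4 := mul_lt_mul_of_pos_left h1 hpos
    linarith

/-- The polar of a body of constant diameter `D` has constant diameter `π - D`. -/
theorem dual (hc : IsConstDiam K L c) (h : IsDualPair K L) (hm : 0 < m) :
    IsConstDiam L K (-c) := by
  refine ⟨hc.neg_le_dot h hm, fun X hX hb => ?_⟩
  suffices hY : ∃ Y ∈ K, dot X Y ≤ -c by
    obtain ⟨Y, hY, hXY⟩ := hY
    exact ⟨Y, hY, le_antisymm hXY (hc.neg_le_dot h hm X hX Y hY)⟩
  obtain ⟨P, hP, hPX⟩ := hb
  have hc1 := hc.lt_one h hm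
  have hc2 := hc.neg_one_lt h hm
  have hs0 := sqrt_one_sub_sq_pos hc2 hc1
  -- For `c ≤ 0` the normal `X'` at `P`, coming from its partner, is far enough from `X`: `X' ⬝ X =
  -- -c (Z ⬝ X) ≤ -c`. For `c > 0` the sign of this bound reverses, so the farthest point of `K` is
  -- used instead.
  rcases le_or_gt c 0 with hc0 | hc0
  · obtain ⟨R, hR, hPR, ⟨Z, hZ, hZin⟩, X', hX', hXin⟩ :=
      hc.exists_partner h hm hP ⟨X, hX, by rw [dot_comm, hPX]⟩
    refine ⟨X', hX', ?_⟩
    have h1 := hXin X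
    have h2 := hZin X
    rw [hPX] at h1 h2
    have h3 : √(1 - c ^ 2) * dot X' X = √(1 - c ^ 2) * (-c * dot Z X) := by
      rw [h2] at h1; linear_combination -h1
    rw [dot_comm, mul_left_cancel₀ hs0.ne' h3]
    nlinarith [dot_le_one Z X]
  · obtain ⟨Y, hY, hmin⟩ := h.exists_min X
    refine ⟨Y, hY, ?_⟩
    have hPK : P ∈ K := (h.mem_left P).2 fun Q hQ => hc0.le.trans (hc.le_dot P hP Q hQ)
    have ha0 : dot X Y ≤ 0 := (hmin P hPK).trans_eq (by rw [dot_comm, hPX])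
    have ha1 := h.neg_one_lt_dot hX hY
    have he0 := sqrt_one_sub_sq_pos ha1 (by linarith)
    have he2 := sq_sqrt_one_sub_sq ha1 (by linarith)
    obtain ⟨Q, hQ, hQin⟩ := h.symm.exists_normal (by nlinarith) hY rfl hmin
    have h1 := hQin P
    rw [dot_comm X P, hPX] at h1
    have h2 := hc.le_dot Q hQ P hP
    have h3 := sq_dot_add_sq_dot_le_one hPX Y
    rw [dot_comm Y X] at h3
    set a := dot X Y
    set e := √(1 - a ^ 2)
    -- Combined with `a ≤ 0`, this bounds `e (Q ⬝ P) = -a (Y ⬝ P)` above by `-a e`, while `Q ⬝ P ≥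
    -- c`.
    have h4 : dot Y P ≤ e := by nlinarith
    have h5 : e * c ≤ e * (-a) := by nlinarith
    linarith [le_of_mul_le_mul_left h5 he0]

end IsConstDiam

/-! ### Polar sets and their interiors -/

lemma mem_polar {m : ℕ} {W : Set (Sph m)} {Q : Sph m} : Q ∈ polar W ↔ ∀ P ∈ W, 0 ≤ dot P Q := by
  simp [polar, hemisphere]

lemma subset_hemisphere_iff {m : ℕ} {W : Set (Sph m)} {Q : Sph m} :
    W ⊆ hemisphere Q ↔ Q ∈ polar W := by
  rw [mem_polar]
  exact forall₂_congr fun P _ => by rw [dot_comm P Q]; rfl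

lemma subset_polar_polar {m : ℕ} (W : Set (Sph m)) : W ⊆ polar (polar W) := fun X hX =>
  mem_polar.2 fun P hP => by rw [dot_comm]; exact mem_polar.1 hP X hX

lemma polar_anti {m : ℕ} {V W : Set (Sph m)} (h : V ⊆ W) : polar W ⊆ polar V := fun _ hX =>
  mem_polar.2 fun P hP => mem_polar.1 hX P (h hP)

/-- A point at positive scalar product with all points of a compact set is interior to its polar. -/
lemma mem_interior_polar {m : ℕ} {A : Set (Sph m)} (hA : IsCompact A) {o : Sph m}
    (ho : ∀ P ∈ A, 0 < dot o P) : o ∈ interior (polar A) := by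
  rcases A.eq_empty_or_nonempty with rfl | hne
  · simp [polar]
  obtain ⟨P₀, hP₀, hmin⟩ := hA.exists_isMinOn hne (continuous_dot_left o).continuousOn
  refine mem_interior_iff_mem_nhds.2 (Metric.mem_nhds_iff.2 ⟨dot o P₀, ho P₀ hP₀, fun X hX =>
    mem_polar.2 fun P hP => ?_⟩)
  have h1 : dot o P₀ ≤ dot o P := hmin hP
  have h2 := real_inner_le_norm ((o : EuclideanSpace ℝ (Fin (m + 1))) - X) P
  rw [inner_sub_left, norm_coe, mul_one, ← dist_eq_norm, dist_comm] at h2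
  have h3 : dist (X : EuclideanSpace ℝ (Fin (m + 1))) o < dot o P₀ := hX
  rw [dot_comm]
  unfold dot at *
  linarith

/-- If `P ⬝ X = 0`, pushing `X` slightly along `-P` leaves the polar. The push and the
renormalization each move the point by at most `r / 3`, so it stays in the ball of radius `r`. -/
lemma dot_pos_of_mem_interior_polar {m : ℕ} {A : Set (Sph m)} {X P : Sph m}
    (hX : X ∈ interior (polar A)) (hP : P ∈ A) : 0 < dot P X := by
  refine lt_of_le_of_ne (mem_polar.1 (interior_subset hX) P hP) fun he => ?_
  obtain ⟨r, hr, hball⟩ := Metric.mem_nhds_iff.1 (mem_interior_iff_mem_nhds.1 hX)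
  set W : EuclideanSpace ℝ (Fin (m + 1)) := X.1 - (r / 3) • P.1 with hW
  have hWP : inner ℝ (P : EuclideanSpace ℝ (Fin (m + 1))) W = - (r / 3) := by
    rw [hW, inner_sub_right, inner_smul_right, ← dot.eq_1, ← dot.eq_1, ← he, dot_self]; ring
  have hWX : ‖W - X‖ = r / 3 := by
    rw [hW, sub_sub_cancel_left, norm_neg, norm_smul, norm_coe, Real.norm_of_nonneg (by positivity),
      mul_one]
  have hW0 : W ≠ 0 := fun h0 => by
    rw [h0, inner_zero_right] at hWP; linarith
  obtain ⟨Z, hZ⟩ := exists_normalize hW0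
  have h1 : ‖(Z : EuclideanSpace ℝ (Fin (m + 1))) - W‖ ≤ r / 3 := by
    have hZ1 : (Z : EuclideanSpace ℝ (Fin (m + 1))) - W = Z.1 - ‖W‖ • Z.1 := by rw [← hZ]
    rw [hZ1, show (Z : EuclideanSpace ℝ (Fin (m + 1))) - ‖W‖ • Z.1 = (1 - ‖W‖) • Z.1 by module,
      norm_smul, norm_coe, mul_one, Real.norm_eq_abs, ← norm_coe X, ← hWX,
      norm_sub_rev W]
    exact abs_norm_sub_norm_le _ _
  have h2 : Z ∈ polar A := hball (by
    have h3 : dist (Z : EuclideanSpace ℝ (Fin (m + 1))) X < r := by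
      rw [dist_eq_norm]
      linarith [norm_sub_le_norm_sub_add_norm_sub (Z : EuclideanSpace ℝ (Fin (m + 1))) W X]
    exact h3)
  rw [hZ, inner_smul_right] at hWP
  have h4 := mul_nonneg (norm_nonneg W) (mem_polar.1 h2 P hP)
  unfold dot at h4
  linarith

/-! ### Width and diameter in terms of the polar -/

namespace IsDualPair

variable {m : ℕ} {K L : Set (Sph m)} {c : ℝ}

lemma polar_left (h : IsDualPair K L) : polar K = L := by
  ext P
  rw [mem_polar, h.mem_right]
  exact forall₂_congr fun X _ => by rw [dot_comm]

lemma mem_interior_iff (h : IsDualPair K L) {X : Sph m} :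
    X ∈ interior K ↔ ∀ P ∈ L, 0 < dot X P := by
  rw [← h.symm.polar_left]
  refine ⟨fun hX P hP => ?_, fun hX => mem_interior_polar h.symm.isCompact_left hX⟩
  rw [dot_comm]
  exact dot_pos_of_mem_interior_polar hX hP

lemma isSphericalConvexBody (h : IsDualPair K L) : IsSphericalConvexBody K := by
  obtain ⟨o, ho, ho'⟩ := h.exists_left
  refine ⟨h.isClosed_left, ?_, o, h.mem_interior_iff.2 ho'⟩
  rintro _ ⟨c, hc, u, hu, rfl⟩ _ ⟨d, hd, v, hv, rfl⟩ a b ha hb hab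
  obtain ⟨q, hq, hq'⟩ := h.exists_right
  set W : EuclideanSpace ℝ (Fin (m + 1)) := a • c • u.1 + b • d • v.1 with hW
  have hWin : ∀ x : Sph m, inner ℝ W (x : EuclideanSpace ℝ (Fin (m + 1)))
      = a * (c * dot u x) + b * (d * dot v x) := fun x => by
    simp [hW, inner_add_left, inner_smul_left, dot]
  have hW0 : W ≠ 0 := fun h0 => by
    have h1 := hWin q
    rw [h0, inner_zero_left, dot_comm u, dot_comm v] at h1
    have hu' := mul_pos hc (hq' u hu)
    have hv' := mul_pos hd (hq' v hv)
    rcases ha.eq_or_lt with rfl | ha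
    · rw [zero_add] at hab
      subst hab
      linarith
    · have := mul_pos ha hu'
      have := mul_nonneg hb hv'.le
      linarith
  obtain ⟨Z, hZ, hWZ⟩ := h.exists_mem_left hW0 fun P hP => by
    rw [hWin]
    have := h.dot_nonneg hu hP
    have := h.dot_nonneg hv hP
    positivity
  exact ⟨‖W‖, norm_pos_iff.2 hW0, Z, hZ, hWZ⟩

lemma isSupporting_iff (h : IsDualPair K L) {P : Sph m} :
    IsSupporting K P ↔ P ∈ L ∧ ∃ X ∈ K, dot X P = 0 := by
  rw [IsSupporting, subset_hemisphere_iff, h.polar_left]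
  refine and_congr_right fun hP => ⟨?_, ?_⟩
  · rintro ⟨X, hX, hXP⟩
    exact ⟨X, h.isClosed_left.frontier_subset hX, by rw [dot_comm]; exact hXP⟩
  · rintro ⟨X, hX, hXP⟩
    refine ⟨X, ⟨subset_closure hX, fun hint => ?_⟩, by rw [← dot_comm] at hXP; exact hXP⟩
    exact (h.mem_interior_iff.1 hint P hP).ne' hXP

/-- The farthest point `Q` is an admissible lune partner: it is not `P`, since a boundary point is
not all of `L`, and not `-P`, since `L` has no antipodal pair. -/
lemma widthAt_eq (h : IsDualPair K L) {P Q : Sph m} (hP : P ∈ L) (hb : ∃ X ∈ K, dot X P = 0)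
    (hQ : Q ∈ L) (hmin : ∀ y ∈ L, dot P Q ≤ dot P y) :
    widthAt K P = Real.pi - Real.arccos (dot P Q) := by
  refine IsLeast.csInf_eq ⟨⟨Q, ⟨?_, ?_⟩, ?_, rfl⟩, ?_⟩
  · rintro rfl
    obtain ⟨o, ho, ho'⟩ := h.exists_dot_lt_one_of_boundary hb
    rw [dot_self] at hmin
    exact (hmin o ho).not_gt ho'
  · intro he
    have := h.symm.neg_one_lt_dot hP hQ
    rw [he, neg_dot, dot_self] at this
    exact lt_irrefl _ this
  · rwa [subset_hemisphere_iff, h.polar_left]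
  · rintro _ ⟨R, -, hR, rfl⟩
    rw [subset_hemisphere_iff, h.polar_left] at hR
    exact sub_le_sub_left (Real.arccos_le_arccos (hmin R hR)) _

/-- Constant width of a body amounts to constant diameter of its polar. -/
lemma exists_isConstDiam (h : IsDualPair K L) (hm : 0 < m) (hK : HasConstantWidth K) :
    ∃ c, IsConstDiam K L c := by
  obtain ⟨P₀, hP₀, Q₀, hQ₀, hb₀, hmin₀⟩ := h.symm.exists_boundary_min_pair hm
  refine ⟨dot P₀ Q₀, hmin₀, fun P hP hb => ?_⟩
  obtain ⟨Q, hQ, hmin⟩ := h.symm.exists_min P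
  refine ⟨Q, hQ, ?_⟩
  have h1 := hK P P₀ (h.isSupporting_iff.2 ⟨hP, hb⟩) (h.isSupporting_iff.2 ⟨hP₀, hb₀⟩)
  rw [h.widthAt_eq hP hb hQ hmin, h.widthAt_eq hP₀ hb₀ hQ₀ (hmin₀ P₀ hP₀)] at h1
  exact Real.arccos_injOn ⟨neg_one_le_dot _ _, dot_le_one _ _⟩
    ⟨neg_one_le_dot _ _, dot_le_one _ _⟩ (by linarith)

end IsDualPair

namespace IsConstDiam

variable {m : ℕ} {K L : Set (Sph m)} {c : ℝ}

lemma widthAt_eq (hc : IsConstDiam K L c) (h : IsDualPair K L) {P : Sph m}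
    (hP : IsSupporting K P) : widthAt K P = Real.pi - Real.arccos c := by
  obtain ⟨hPL, hb⟩ := h.isSupporting_iff.1 hP
  obtain ⟨Q, hQ, rfl⟩ := hc.exists_dot_eq P hPL hb
  exact h.widthAt_eq hPL hb hQ (hc.le_dot P hPL)

lemma hasConstantWidth (hc : IsConstDiam K L c) (h : IsDualPair K L) : HasConstantWidth K :=
  fun _ _ hP hP' => (hc.widthAt_eq h hP).trans (hc.widthAt_eq h hP').symm

lemma swidth_eq (hc : IsConstDiam K L c) (h : IsDualPair K L) (hm : 0 < m) :
    swidth K = Real.pi - Real.arccos c := by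
  obtain ⟨P, hP, -, -, hb, -⟩ := h.symm.exists_boundary_min_pair hm
  have hs := h.isSupporting_iff.2 ⟨hP, hb⟩
  refine IsLeast.csInf_eq ⟨⟨P, hs, (hc.widthAt_eq h hs).symm⟩, ?_⟩
  rintro _ ⟨P', hP', rfl⟩
  exact (hc.widthAt_eq h hP').ge

lemma sdiam_eq (hc : IsConstDiam K L c) (h : IsDualPair K L) (hm : 0 < m) :
    sdiam L = Real.arccos c := by
  obtain ⟨P, hP, -, -, hb, -⟩ := h.symm.exists_boundary_min_pair hm
  obtain ⟨Q, hQ, hPQ⟩ := hc.exists_dot_eq P hP hb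
  refine IsGreatest.csSup_eq ⟨⟨P, hP, Q, hQ, by rw [sdist, hPQ]⟩, ?_⟩
  rintro _ ⟨P', hP', Q', hQ', rfl⟩
  exact Real.arccos_le_arccos (hc.le_dot P' hP' Q' hQ')

end IsConstDiam

/-! ### The spherical Wulff shape as a polar set -/

section Wulff

variable {n : ℕ} {γ : Sph n → ℝ}

/-- The vector `(-θ, γ θ)`, the inner normal of the half-space `x ⬝ θ ≤ γ θ` lifted to a cone. -/
noncomputable def liftedNormal (γ : Sph n → ℝ) (θ : Sph n) : EuclideanSpace ℝ (Fin (n + 2)) :=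
  WithLp.toLp 2 (Fin.snoc (α := fun _ => ℝ) (fun i => -θ.1 i) (γ θ))

lemma inner_liftedNormal (γ : Sph n → ℝ) (θ : Sph n) (x : EuclideanSpace ℝ (Fin (n + 2))) :
    inner ℝ (liftedNormal γ θ) x
      = -(∑ i : Fin (n + 1), x i.castSucc * θ.1 i) + x (Fin.last (n + 1)) * γ θ := by
  simp [liftedNormal, PiLp.inner_apply, Fin.sum_univ_castSucc]

lemma dot_northPole (P : Sph (n + 1)) : dot (northPole n) P = P.1 (Fin.last (n + 1)) := by
  rw [dot, northPole, EuclideanSpace.inner_single_left]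
  simp

lemma mem_sphericalWulffShape {P : Sph (n + 1)} : P ∈ sphericalWulffShape γ ↔
    0 < P.1 (Fin.last (n + 1)) ∧
      ∀ θ, 0 ≤ inner ℝ (liftedNormal γ θ) (P : EuclideanSpace ℝ (Fin (n + 2))) := by
  have hN : P ∈ northOpen n ↔ 0 < P.1 (Fin.last (n + 1)) := by
    simp only [northOpen, hemisphere, hypersphere, Set.mem_sdiff, Set.mem_ofPred_eq, dot_northPole]
    exact ⟨fun h => lt_of_le_of_ne h.1 (Ne.symm h.2), fun h => ⟨h.le, h.ne'⟩⟩
  rw [sphericalWulffShape, Set.mem_ofPred_eq, hN]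
  refine and_congr_right fun hpos => ?_
  set p := P.1 (Fin.last (n + 1)) with hp
  have key : ∀ θ : Sph n, 0 ≤ inner ℝ (liftedNormal γ θ) (P : EuclideanSpace ℝ (Fin (n + 2))) ↔
      ∑ i : Fin (n + 1), P.1 i.castSucc / p * θ.1 i ≤ γ θ := fun θ => by
    rw [inner_liftedNormal]
    have : ∑ i : Fin (n + 1), P.1 i.castSucc / p * θ.1 i
        = (∑ i : Fin (n + 1), P.1 i.castSucc * θ.1 i) / p := by
      rw [Finset.sum_div]
      exact Finset.sum_congr rfl fun i _ => by ring
    rw [this, div_le_iff₀ hpos, ← hp, neg_add_eq_sub, sub_nonneg, mul_comm]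
  simp only [key]
  constructor
  · rintro ⟨x, hx, hxP⟩ θ
    have h1 : ∀ i : Fin (n + 1), P.1 i.castSucc / p = x i := fun i => by
      have := congrArg (fun v : EuclideanSpace ℝ (Fin (n + 2)) => v i.castSucc) hxP
      simpa [liftOne, centralProj] using this.symm
    have h2 := Set.mem_iInter.1 hx θ
    simpa [h1, PiLp.inner_apply, mul_comm] using h2
  · intro h
    refine ⟨WithLp.toLp 2 fun i => P.1 i.castSucc / p, Set.mem_iInter.2 fun θ => ?_, ?_⟩
    · simpa [PiLp.inner_apply, mul_comm] using h θ
    · ext i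
      refine Fin.lastCases ?_ (fun j => ?_) i
      · simp [liftOne, centralProj, ← hp, hpos.ne']
      · simp [liftOne, centralProj, ← hp]

lemma liftedNormal_ne_zero (hpos : ∀ θ, 0 < γ θ) (θ : Sph n) : liftedNormal γ θ ≠ 0 := fun h0 => by
  have := congrArg (fun v : EuclideanSpace ℝ (Fin (n + 2)) => v (Fin.last (n + 1))) h0
  simp [liftedNormal, (hpos θ).ne'] at this

/-- The point of the sphere in the direction of `(-θ, γ θ)`. -/
noncomputable def normalPoint (hpos : ∀ θ, 0 < γ θ) (θ : Sph n) : Sph (n + 1) :=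
  ⟨‖liftedNormal γ θ‖⁻¹ • liftedNormal γ θ, by
    simp [norm_smul, liftedNormal_ne_zero hpos θ]⟩

lemma dot_normalPoint (hpos : ∀ θ, 0 < γ θ) (θ : Sph n) (P : Sph (n + 1)) :
    dot (normalPoint hpos θ) P = ‖liftedNormal γ θ‖⁻¹ *
      inner ℝ (liftedNormal γ θ) (P : EuclideanSpace ℝ (Fin (n + 2))) := by
  simp [dot, normalPoint, inner_smul_left]

lemma continuous_liftedNormal (hγ : Continuous γ) : Continuous (liftedNormal γ) := by
  refine (PiLp.continuous_toLp 2 _).comp (continuous_pi fun i => ?_)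
  refine Fin.lastCases ?_ (fun j => ?_) i
  · simpa using hγ
  · simp only [Fin.snoc_castSucc]
    fun_prop

lemma continuous_normalPoint (hγ : Continuous γ) (hpos : ∀ θ, 0 < γ θ) :
    Continuous (normalPoint hpos) :=
  Continuous.subtype_mk (((continuous_liftedNormal hγ).norm.inv₀ fun θ =>
    norm_ne_zero_iff.2 (liftedNormal_ne_zero hpos θ)).smul (continuous_liftedNormal hγ)) _

/-- Take `θ` along the horizontal part of `P`, or arbitrary if that part vanishes. Thus the
half-space conditions alone force a positive last coordinate. -/
lemma exists_dot_neg_of_last_nonpos (hpos : ∀ θ, 0 < γ θ) {P : Sph (n + 1)}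
    (hP : P.1 (Fin.last (n + 1)) ≤ 0) :
    ∃ θ, inner ℝ (liftedNormal γ θ) (P : EuclideanSpace ℝ (Fin (n + 2))) < 0 := by
  obtain ⟨p, hp⟩ : ∃ p : EuclideanSpace ℝ (Fin (n + 1)), p = WithLp.toLp 2 fun i => P.1 i.castSucc :=
    ⟨_, rfl⟩
  have hin : ∀ θ : Sph n, inner ℝ (liftedNormal γ θ) (P : EuclideanSpace ℝ (Fin (n + 2)))
      = -inner ℝ p θ.1 + P.1 (Fin.last (n + 1)) * γ θ := fun θ => by
    rw [inner_liftedNormal]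
    simp [hp, PiLp.inner_apply, mul_comm]
  rcases eq_or_ne p 0 with h0 | h0
  · obtain ⟨θ⟩ : Nonempty (Sph n) := ⟨⟨EuclideanSpace.single 0 1, by simp⟩⟩
    refine ⟨θ, ?_⟩
    have h1 : P.1 (Fin.last (n + 1)) ≠ 0 := fun hl => by
      have h2 : P.1 = 0 := by
        ext i
        refine Fin.lastCases (by simpa using hl) (fun j => ?_) i
        have h3 := congrArg (fun v : EuclideanSpace ℝ (Fin (n + 1)) => v j) (hp.symm.trans h0)
        simpa using h3
      have h4 := norm_coe P
      rw [h2, norm_zero] at h4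
      exact zero_ne_one h4
    rw [hin, h0, inner_zero_left, neg_zero, zero_add]
    exact mul_neg_of_neg_of_pos (lt_of_le_of_ne hP h1) (hpos θ)
  · obtain ⟨θ, hθ⟩ := exists_normalize h0
    refine ⟨θ, ?_⟩
    have h1 : inner ℝ p (θ : EuclideanSpace ℝ (Fin (n + 1))) = ‖p‖ := by
      nth_rw 1 [hθ]
      rw [inner_smul_left, ← dot.eq_1, dot_self]; simp
    rw [hin, h1]
    have h2 := norm_pos_iff.2 h0
    have h3 := mul_nonneg (neg_nonneg.2 hP) (hpos θ).le
    linarith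

lemma sphericalWulffShape_eq_polar (hpos : ∀ θ, 0 < γ θ) :
    sphericalWulffShape γ = polar (Set.range (normalPoint hpos)) := by
  ext P
  rw [mem_sphericalWulffShape, mem_polar, Set.forall_mem_range]
  have key : ∀ θ, 0 ≤ dot (normalPoint hpos θ) P ↔
      0 ≤ inner ℝ (liftedNormal γ θ) (P : EuclideanSpace ℝ (Fin (n + 2))) := fun θ => by
    rw [dot_normalPoint]
    exact mul_nonneg_iff_of_pos_left
      (inv_pos.2 (norm_pos_iff.2 (liftedNormal_ne_zero hpos θ)))
  simp only [key]
  refine ⟨fun h => h.2, fun h => ⟨?_, h⟩⟩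
  by_contra! hle
  obtain ⟨θ, hθ⟩ := exists_dot_neg_of_last_nonpos hpos hle
  exact (h θ).not_gt hθ

/-- The north pole is the interior point on both sides: it has positive products with the compact
set of normals and with the shape, which lies in the open hemisphere. -/
lemma isDualPair_sphericalWulffShape (hγ : Continuous γ) (hpos : ∀ θ, 0 < γ θ) :
    IsDualPair (sphericalWulffShape γ) (polar (sphericalWulffShape γ)) := by
  have hA : IsCompact (Set.range (normalPoint hpos)) :=
    isCompact_range (continuous_normalPoint hγ hpos)
  have hNK : ∀ X ∈ sphericalWulffShape γ, 0 < dot (northPole n) X := fun X hX => by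
    rw [dot_northPole]
    exact (mem_sphericalWulffShape.1 hX).1
  have hbi : polar (polar (sphericalWulffShape γ)) = sphericalWulffShape γ := by
    refine (subset_polar_polar _).antisymm' ?_
    nth_rw 2 [sphericalWulffShape_eq_polar hpos]
    rw [sphericalWulffShape_eq_polar hpos]
    exact polar_anti (subset_polar_polar _)
  have hNint : northPole n ∈ interior (polar (polar (sphericalWulffShape γ))) := by
    rw [hbi, sphericalWulffShape_eq_polar hpos]
    refine mem_interior_polar hA (Set.forall_mem_range.2 fun θ => ?_)
    rw [dot_northPole]
    simp only [normalPoint, liftedNormal, PiLp.smul_apply, Fin.snoc_last, smul_eq_mul]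
    exact mul_pos (inv_pos.2 (norm_pos_iff.2 (liftedNormal_ne_zero hpos θ))) (hpos θ)
  refine ⟨fun X => ?_, fun P => ?_, ⟨northPole n, ?_, fun P hP => ?_⟩, northPole n, ?_, hNK⟩
  · nth_rw 1 [← hbi]
    rw [mem_polar]
    exact forall₂_congr fun P _ => by rw [dot_comm]
  · rw [mem_polar]
    exact forall₂_congr fun X _ => by rw [dot_comm]
  · rw [← hbi]
    exact interior_subset hNint
  · rw [dot_comm]
    exact dot_pos_of_mem_interior_polar hNint hP
  · exact mem_polar.2 fun X hX => by rw [dot_comm]; exact (hNK X hX).le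

end Wulff

end SphericalWulff

theorem mainTheorem5 (n : ℕ) (γ : SphericalWulff.Sph n → ℝ) (hγ : Continuous γ)
    (hpos : ∀ θ, 0 < γ θ)
    (hW : SphericalWulff.HasConstantWidth (SphericalWulff.sphericalWulffShape γ)) :
    SphericalWulff.IsSphericalConvexBody (SphericalWulff.sphericalWulffShape γ) ∧
    SphericalWulff.IsSphericalConvexBody
      (SphericalWulff.polar (SphericalWulff.sphericalWulffShape γ)) ∧
    SphericalWulff.HasConstantWidth
      (SphericalWulff.polar (SphericalWulff.sphericalWulffShape γ)) ∧
    SphericalWulff.swidth (SphericalWulff.sphericalWulffShape γ) +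
      SphericalWulff.sdiam (SphericalWulff.polar (SphericalWulff.sphericalWulffShape γ)) =
        Real.pi ∧
    SphericalWulff.swidth (SphericalWulff.sphericalWulffShape γ) +
      SphericalWulff.swidth (SphericalWulff.polar (SphericalWulff.sphericalWulffShape γ)) =
        Real.pi ∧
    SphericalWulff.sdiam (SphericalWulff.sphericalWulffShape γ) +
      SphericalWulff.swidth (SphericalWulff.polar (SphericalWulff.sphericalWulffShape γ)) =
        Real.pi ∧
    SphericalWulff.sdiam (SphericalWulff.sphericalWulffShape γ) +
      SphericalWulff.sdiam (SphericalWulff.polar (SphericalWulff.sphericalWulffShape γ)) =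
        Real.pi := by
  have h := SphericalWulff.isDualPair_sphericalWulffShape hγ hpos
  have hm : 0 < n + 1 := n.succ_pos
  obtain ⟨c, hc⟩ := h.exists_isConstDiam hm hW
  have hc' := hc.dual h hm
  have e1 := hc.swidth_eq h hm
  have e2 := hc.sdiam_eq h hm
  have e3 := hc'.swidth_eq h.symm hm
  have e4 := hc'.sdiam_eq h.symm hm
  rw [Real.arccos_neg] at e3 e4
  refine ⟨h.isSphericalConvexBody, h.symm.isSphericalConvexBody, hc'.hasConstantWidth h.symm,
    ?_, ?_, ?_, ?_⟩ <;> linarith
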